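/- Let $I\ge 0$ be an integer and $q,u\in\mathbb C$. Let $\mathrm e_0,\dots,\mathrm e_I$ be the standard basis of $\mathbb C^{I+1}$. The unfused $R$ matrix on $\mathbb C^2\otimes\mathbb C^2$ is, in the basis $\mathrm e_0\otimes\mathrm e_0,\ \mathrm e_0\otimes\mathrm e_1,\ \mathrm e_1\otimes\mathrm e_0,\ \mathrm e_1\otimes\mathrm e_1$ (columns are images of basis vectors), $$\mathsf R(u)=\begin{bmatrix}1&0&0&0\\0&\frac{q(1-u)}{1-qu}&\frac{u(1-q)}{1-qu}&0\\0&\frac{1-q}{1-qu}&\frac{1-u}{1-qu}&0\\0&0&0&1\end{bmatrix}.$$ Let $\mathsf R_{ij}(u)$ be $\mathsf R(u)$ acting on the $i$-th and $j$-th factors of $(\mathbb C^2)^{\otimes 2I}=(\mathbb C^2)^{\otimes I}\otimes(\mathbb C^2)^{\otimes I}$, and put $$\mathring{\mathsf R}^I(u)=\prod_{a\in\{1,\dots,I\}}^{\longleftarrow}\ \prod_{b\in\{1,\dots,I\}}^{\longrightarrow}\mathsf R_{b,a+I}\left(uq^{b-a}\right),$$ where the inner product is performed first and a left (right) arrow means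 that the factors are written from left to right in decreasing (increasing) order of the index. Define $\Pi:(\mathbb C^2)^{\otimes I}\to\mathbb C^{I+1}$ and $\widehat\Pi:\mathbb C^{I+1}\to(\mathbb C^2)^{\otimes I}$ by $$\Pi(\mathrm e_{a_1}\otimes\dots\otimes\mathrm e_{a_I})=\mathrm e_{a_1+\dots+a_I},\qquad \widehat\Pi(\mathrm e_a)=\frac{1}{Z_q(I;a)}\sum_{\substack{a_1,\dots,a_I\in\{0,1\}\\ a_1+\dots+a_I=a}}q^{\mathrm{inv}(a_1,\dots,a_I)}\,\mathrm e_{a_1}\otimes\dots\otimes\mathrm e_{a_I},$$ where $\mathrm{inv}(a_1,\dots,a_I)=\#\{i<j: a_i>a_j\}$ and $Z_q(I;a)=\sum_{a_1+\dots+a_I=a}q^{\mathrm{inv}(a_1,\dots,a_I)}$. The fused $R$ matrix is $$\mathsf R^I(u)=(\Pi\otimes\Pi)\circ\mathring{\mathsf R}^I(u)\circ(\widehat\Pi\otimes\widehat\Pi)\in\mathrm{End}\left(\mathbb C^{I+1}\otimes\mathbb C^{I+1}\right),$$ and $\mathsf R^I(u)_{a,b}^{c,d}$ denotes the coefficient of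 $\mathrm e_c\otimes\mathrm e_d$ in $\mathsf R^I(u)(\mathrm e_a\otimes\mathrm e_b)$. For $n\in\mathbb N_0$ let $(x;s)_n=(1-x)(1-sx)\cdots(1-s^{n-1}x)$, and for $0\le i\le j$ let $$\Phi_{q^{-1}}(i,j;x,y)=\left(\frac yx\right)^i\frac{(x;q^{-1})_i\,(\frac yx;q^{-1})_{j-i}}{(y;q^{-1})_j}\,\frac{(q^{-1};q^{-1})_j}{(q^{-1};q^{-1})_i\,(q^{-1};q^{-1})_{j-i}}.$$ Theorem. Let $q\neq0$, $u\neq 0$, $q^k\ne1$ for $1\le k\le I$, and $q\cdot uq^{i-j}\neq1$ for all $1\le i,j\le I$. Then for all $0\le a,b,c,d\le I$ such that $(q^Iu;q^{-1})_{c+d}\neq0$, $$\mathsf R^I(u)_{a,b}^{c,d}=\mathbf 1_{a+b=c+d}\;u^{d-b}q^{(d-a)I}\sum_{p=0}^{\min(b,c)}\Phi_{q^{-1}}\left(c-p,c+d-p;u,q^Iu\right)\Phi_{q^{-1}}\left(p,b;q^I/u,q^I\right).$$ (The conditions guarantee that no denominator vanishes in the definition of $\mathsf R^I(u)$ or in the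 formula; given the others, the last one fails only for $c=d=I$, $u=q^{I-1}$.) -/

import Mathlib

open scoped Kronecker

noncomputable section

namespace FusedSixVertex

/-- The `q`-Pochhammer symbol `(x; s)_n = (1 - x)(1 - s x) ⋯ (1 - s^(n-1) x)`. -/
def qPoch (s x : ℂ) (n : ℕ) : ℂ := ∏ k ∈ Finset.range n, (1 - s ^ k * x)

/-- The function `Φ_s(i, j; x, y)`, for `0 ≤ i ≤ j`. -/
def Phi (s : ℂ) (i j : ℕ) (x y : ℂ) : ℂ :=
  (y / x) ^ i * ((qPoch s x i * qPoch s (y / x) (j - i)) / qPoch s y j) *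
    (qPoch s s j / (qPoch s s i * qPoch s s (j - i)))

/-! Operators are represented by their matrices in the natural bases. The basis of the tensor
product of copies of `ℂ²` indexed by `ι` is `ι → Fin 2`, the function `σ` standing for the tensor
product of the `e_{σ i}`. As usual the matrix entry `M σ τ` is the coefficient of the basis
vector `σ` in the image of the basis vector `τ`. -/

/-- The unfused `R` matrix on `ℂ² ⊗ ℂ²`, in the ordered basis
`e₀ ⊗ e₀, e₀ ⊗ e₁, e₁ ⊗ e₀, e₁ ⊗ e₁`. -/
def unfusedR4 (q u : ℂ) : Matrix (Fin 4) (Fin 4) ℂ :=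
  !![1, 0, 0, 0;
     0, q * (1 - u) / (1 - q * u), u * (1 - q) / (1 - q * u), 0;
     0, (1 - q) / (1 - q * u), (1 - u) / (1 - q * u), 0;
     0, 0, 0, 1]

/-- The unfused `R` matrix, with rows and columns indexed by pairs; the pair `(a, b)` is
number `2 a + b` in the ordered basis above. -/
def unfusedR (q u : ℂ) : Matrix (Fin 2 × Fin 2) (Fin 2 × Fin 2) ℂ :=
  (unfusedR4 q u).submatrix (fun p => finProdFinEquiv p) (fun p => finProdFinEquiv p)

/-- `M` acting on the tensor factors `i` and `j` (in this order, `i ≠ j`) of `(ℂ²)^{⊗ ι}`, and as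
the identity on all the other factors. -/
def actOn {ι : Type*} [Fintype ι] [DecidableEq ι]
    (M : Matrix (Fin 2 × Fin 2) (Fin 2 × Fin 2) ℂ) (i j : ι) :
    Matrix (ι → Fin 2) (ι → Fin 2) ℂ :=
  Matrix.of fun σ τ =>
    if ∀ k, k ≠ i → k ≠ j → σ k = τ k then M (σ i, σ j) (τ i, τ j) else 0

/-- The operator on `(ℂ²)^{⊗ I} ⊗ (ℂ²)^{⊗ I}` given by the ordered product, over `a` decreasing from
left to right and, inside, over `b` increasing from left to right, of `R_{b, a+I}(u q^{b-a})`.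
The factor `b` is `Sum.inl b` and the factor `a + I` is `Sum.inr a`. -/
def fusedROp (I : ℕ) (q u : ℂ) :
    Matrix (Fin I ⊕ Fin I → Fin 2) (Fin I ⊕ Fin I → Fin 2) ℂ :=
  ((List.finRange I).reverse.map fun a : Fin I =>
    ((List.finRange I).map fun b : Fin I =>
      actOn (unfusedR q (u * q ^ (((b : ℕ) : ℤ) - ((a : ℕ) : ℤ)))) (Sum.inl b) (Sum.inr a)).prod).prod

/-- The number `∑ a_j` of arrows of a configuration. -/
def numArrows {I : ℕ} (σ : Fin I → Fin 2) : ℕ := ∑ j, (σ j : ℕ)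

/-- The number of pairs `i < j` with `a_i > a_j`. -/
def inv {I : ℕ} (σ : Fin I → Fin 2) : ℕ :=
  (Finset.univ.filter fun p : Fin I × Fin I => p.1 < p.2 ∧ σ p.2 < σ p.1).card

/-- The normalization `Z_q(I; a)`, the sum of `q^inv` over all configurations with `a` arrows. -/
def Zq (I : ℕ) (q : ℂ) (a : ℕ) : ℂ :=
  ∑ σ : Fin I → Fin 2, if numArrows σ = a then q ^ inv σ else 0

/-- The surjection `Π : (ℂ²)^{⊗ I} → ℂ^{I+1}`. -/
def projPi (I : ℕ) : Matrix (Fin (I + 1)) (Fin I → Fin 2) ℂ :=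
  Matrix.of fun a σ => if numArrows σ = (a : ℕ) then 1 else 0

/-- The injection `Π̂ : ℂ^{I+1} → (ℂ²)^{⊗ I}` onto the `q`-exchangeable vectors. -/
def injPi (I : ℕ) (q : ℂ) : Matrix (Fin I → Fin 2) (Fin (I + 1)) ℂ :=
  Matrix.of fun σ a => if numArrows σ = (a : ℕ) then q ^ inv σ / Zq I q a else 0

/-- The fused `R` matrix `(Π ⊗ Π) ∘ fusedROp ∘ (Π̂ ⊗ Π̂)` on `ℂ^{I+1} ⊗ ℂ^{I+1}`. -/
def fusedR (I : ℕ) (q u : ℂ) :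
    Matrix (Fin (I + 1) × Fin (I + 1)) (Fin (I + 1) × Fin (I + 1)) ℂ :=
  (projPi I ⊗ₖ projPi I).submatrix id (Equiv.sumArrowEquivProdArrow (Fin I) (Fin I) (Fin 2)) *
    fusedROp I q u *
    (injPi I q ⊗ₖ injPi I q).submatrix (Equiv.sumArrowEquivProdArrow (Fin I) (Fin I) (Fin 2)) id

/-- The entry of the fused `R` matrix with incoming `a` (below), `b` (left) and outgoing
`c` (above), `d` (right) arrows: the coefficient of `e_c ⊗ e_d` in the image of `e_a ⊗ e_b`. -/
def fusedREntry (I : ℕ) (q u : ℂ) (a b c d : Fin (I + 1)) : ℂ :=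
  fusedR I q u (c, d) (a, b)

end FusedSixVertex

end

open scoped Kronecker

noncomputable section

namespace FusedSixVertex

/-! The range of `Π̂` is spanned by the `q`-exchangeable vectors, and the proof rests on their
stability. Splitting one factor off an exchangeable vector leaves an exchangeable vector on the
rest. Hence a whole row of `R` matrices sends an exchangeable vertical vector to an exchangeable
one, with an explicit 2×2 table `rowWeight` of horizontal transitions (`rowOp_mulVec`). Splitting
the exchangeable horizontal input row by row then expresses the full product through the recursively
defined `stackWeight` (`stackOp_mulVec`).

The recursion is solved in closed form by `stackWeight_eq`. Removing the first row changes `(L + 1,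
x)` into `(L, x / q)` and so preserves `y = q ^ L / x`. With `y` fixed, the solution is a sum over
`p` of products `stackTerm`, and each summand satisfies the recursion separately
(`stackTerm_zero_zero` to `stackTerm_one_succ`). Only the initial condition `L = 0` involves the
whole sum; there it is a `q`-Vandermonde sum that vanishes for `b > 0` (`sum_qPoch_telescope`).

The solution depends on the outgoing horizontal configuration `δ` only through its number of arrows
and a factor `q ^ inv δ`, so `Π` merely contributes `Z_q(I; d)`, and `stackTerm_eq_Phi` identifies
the summands. This works when `1 - q ^ k * u ≠ 0` for `|k| ≤ I`; the remaining `u` follow by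
continuity of both sides. -/

/-! ### Exchangeable vectors and the splitting of one factor -/

/-- The unnormalized `q`-exchangeable vector with `a` arrows. -/
def exch (q : ℂ) {M : ℕ} (a : ℤ) (σ : Fin M → Fin 2) : ℂ :=
  if (numArrows σ : ℤ) = a then q ^ inv σ else 0

theorem inv_eq_sum {M : ℕ} (σ : Fin M → Fin 2) :
    inv σ = ∑ i, ∑ j, if i < j ∧ σ j < σ i then 1 else 0 := by
  rw [inv, Finset.card_filter, Fintype.sum_prod_type]

theorem numArrows_castSucc {M : ℕ} (σ : Fin (M + 1) → Fin 2) :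
    numArrows σ = numArrows (σ ∘ Fin.castSucc) + (σ (Fin.last M) : ℕ) := by
  simp [numArrows, Fin.sum_univ_castSucc]

theorem numArrows_succ {M : ℕ} (σ : Fin (M + 1) → Fin 2) :
    numArrows σ = (σ 0 : ℕ) + numArrows (σ ∘ Fin.succ) := by
  simp [numArrows, Fin.sum_univ_succ]

theorem numArrows_le {M : ℕ} (σ : Fin M → Fin 2) : numArrows σ ≤ M := by
  have : numArrows σ ≤ ∑ _j : Fin M, 1 := Finset.sum_le_sum fun j _ => by omega
  simpa using this

theorem inv_castSucc {M : ℕ} (σ : Fin (M + 1) → Fin 2) :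
    inv σ = inv (σ ∘ Fin.castSucc) +
      if σ (Fin.last M) = 0 then numArrows (σ ∘ Fin.castSucc) else 0 := by
  have key : ∀ s t : Fin 2, (if s < t then 1 else 0) = if s = 0 then (t : ℕ) else 0 := by decide
  have h1 : ∀ i : Fin M, ¬ Fin.last M < i.castSucc := fun i => by
    simpa using (Fin.castSucc_lt_last i).le
  simp only [inv_eq_sum, Fin.sum_univ_castSucc, Fin.castSucc_lt_castSucc_iff, numArrows,
    Function.comp, Finset.sum_add_distrib, Fin.castSucc_lt_last, true_and, key, h1, false_and,
    lt_irrefl, if_false, Finset.sum_const_zero, add_zero]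
  split_ifs <;> simp

theorem inv_succ {M : ℕ} (σ : Fin (M + 1) → Fin 2) :
    inv σ + (if σ 0 = 1 then numArrows (σ ∘ Fin.succ) else 0) =
      inv (σ ∘ Fin.succ) + if σ 0 = 1 then M else 0 := by
  have key : ∀ s t : Fin 2, ((if s < t then 1 else 0) : ℕ) = if t = 1 then 1 - (s : ℕ) else 0 := by
    decide
  have h1 : inv σ = inv (σ ∘ Fin.succ) + ∑ j : Fin M, if σ 0 = 1 then 1 - (σ j.succ : ℕ) else 0 := by
    simp only [inv_eq_sum, Fin.sum_univ_succ, Fin.succ_lt_succ_iff, Fin.succ_pos,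
      Function.comp, true_and, key, Fin.not_lt_zero, false_and,
      if_false, zero_add]
    ring
  rw [h1]
  split_ifs
  · rw [add_assoc, numArrows, ← Finset.sum_add_distrib]
    have : ∀ j : Fin M, 1 - (σ j.succ : ℕ) + ((σ ∘ Fin.succ) j : ℕ) = 1 := fun j => by
      simp only [Function.comp]; omega
    rw [Finset.sum_congr rfl fun j _ => this j]
    simp
  · simp

/-- The coefficient with which the last factor `s` splits off an exchangeable vector. -/
def lastCoeff (q : ℂ) (a : ℤ) (s : Fin 2) : ℂ := if s = 0 then q ^ a else 1

/-- The coefficient with which the first factor `s` splits off an exchangeable vector. -/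
def firstCoeff (q : ℂ) (L : ℕ) (b : ℤ) (s : Fin 2) : ℂ := if s = 0 then 1 else q ^ (L + 1 - b)

/-- A final 0 forms an inversion with each of the `a` ones before it, and a final 1 with nothing. -/
theorem exch_castSucc (q : ℂ) {M : ℕ} (a : ℤ) (σ : Fin (M + 1) → Fin 2) :
    exch q a σ = lastCoeff q a (σ (Fin.last M)) *
      exch q (a - (σ (Fin.last M) : ℕ)) (σ ∘ Fin.castSucc) := by
  simp only [exch, lastCoeff, inv_castSucc σ, numArrows_castSucc σ, Nat.cast_add]
  generalize σ (Fin.last M) = s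
  fin_cases s
  · by_cases h : (numArrows (σ ∘ Fin.castSucc) : ℤ) = a
    · simp [h]
      rw [← h, pow_add, zpow_natCast, mul_comm]
    · simp [h]
  · by_cases h : (numArrows (σ ∘ Fin.castSucc) : ℤ) + 1 = a
    · subst h
      simp
    · have h' : ¬ (numArrows (σ ∘ Fin.castSucc) : ℤ) = a - 1 := by omega
      simp [h, h']

/-- An initial 1 forms an inversion with every zero after it, and there are `L - (b - 1)` of them.
-/
theorem exch_succ (q : ℂ) (hq : q ≠ 0) {L : ℕ} (b : ℤ) (σ : Fin (L + 1) → Fin 2) :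
    exch q b σ = firstCoeff q L b (σ 0) * exch q (b - (σ 0 : ℕ)) (σ ∘ Fin.succ) := by
  have h2 := inv_succ σ
  simp only [exch, firstCoeff, numArrows_succ σ, Nat.cast_add]
  generalize σ 0 = s at *
  fin_cases s
  · simp at h2
    simp [h2]
  · simp at h2
    by_cases h : (1 : ℤ) + (numArrows (σ ∘ Fin.succ) : ℤ) = b
    · have h' : (inv σ : ℤ) = (L + 1 - b) + inv (σ ∘ Fin.succ) := by omega
      subst h
      simp
      rw [← zpow_natCast, h', zpow_add₀ hq, zpow_natCast]
    · have h' : ¬ (numArrows (σ ∘ Fin.succ) : ℤ) = b - 1 := by omega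
      simp [h, h']

/-! ### One row acting on an exchangeable vertical vector -/

theorem actOn_mulVec {ι : Type*} [Fintype ι] [DecidableEq ι]
    (A : Matrix (Fin 2 × Fin 2) (Fin 2 × Fin 2) ℂ) {i j : ι} (hij : i ≠ j)
    (v : (ι → Fin 2) → ℂ) (τ : ι → Fin 2) :
    (actOn A i j).mulVec v τ = ∑ s, ∑ b, A (τ i, τ j) (s, b) *
      v (Function.update (Function.update τ i s) j b) := by
  rw [← Fintype.sum_prod_type' (f := fun s b => A (τ i, τ j) (s, b) *
      v (Function.update (Function.update τ i s) j b))]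
  simp only [Matrix.mulVec, dotProduct, actOn, Matrix.of_apply, ite_mul, zero_mul]
  rw [← Finset.sum_filter]
  symm
  refine Finset.sum_nbij' (fun p => Function.update (Function.update τ i p.1) j p.2)
    (fun σ => (σ i, σ j)) ?_ ?_ ?_ ?_ ?_
  · intro p _
    simp only [Finset.mem_filter, Finset.mem_univ, true_and]
    intro k hi hj
    simp [hi, hj]
  · simp
  · intro p _
    simp [hij]
  · intro σ hσ
    simp only [Finset.mem_filter, Finset.mem_univ, true_and] at hσ
    funext k
    by_cases hj : k = j
    · subst hj; simp
    · by_cases hi : k = i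
      · subst hi; simp [hj]
      · simp [hi, hj, hσ k hi hj]
  · intro p _
    simp [hij]

/-- The weights of a row with exchangeable vertical arrows: `a` arrows enter vertically and `b`
horizontally, `d` leave horizontally. -/
def rowWeight (q : ℂ) (M : ℕ) (x : ℂ) (a : ℤ) (b d : Fin 2) : ℂ :=
  !![1 - q ^ (M - a) * x, x * q ^ (M - a) * (1 - q ^ (M - a + 1));
     1 - q ^ (a + 1), q ^ (M - a) - q ^ M * x] b d / (1 - q ^ M * x)

theorem unfusedR_apply (q u : ℂ) (r b' s b : Fin 2) :
    unfusedR q u (r, b') (s, b) =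
      !![!![1, 0; 0, q * (1 - u) / (1 - q * u)], !![0, 0; u * (1 - q) / (1 - q * u), 0];
         !![0, (1 - q) / (1 - q * u); 0, 0], !![(1 - u) / (1 - q * u), 0; 0, 1]] r s b' b := by
  fin_cases r <;> fin_cases b' <;> fin_cases s <;> fin_cases b <;>
    simp [unfusedR, unfusedR4, finProdFinEquiv]

/-- This is the local relation that adds one column to a row. The function `E` stands for the
exchangeable vector on the other `M` columns, of which only the number of arrows matters; each
choice of `r`, `b`, `t` leaves a rational identity in `q`, `x`, `q ^ M`, `q ^ a`. -/
theorem rowWeight_succ (q : ℂ) (hq : q ≠ 0) (M : ℕ) (x : ℂ) (h1 : 1 - q ^ M * x ≠ 0)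
    (h2 : 1 - q ^ (M + 1) * x ≠ 0) (a : ℤ) (r : Fin 2) (b t : Fin 2) (E : ℤ → ℂ) :
    ∑ s : Fin 2, ∑ b' : Fin 2, rowWeight q M x (a - (s : ℕ)) b' t * lastCoeff q a s *
        unfusedR q (x * q ^ M) (r, b') (s, b) * E (a - (s : ℕ) + (b' : ℕ) - (t : ℕ)) =
      rowWeight q (M + 1) x a b t * (lastCoeff q (a + (b : ℕ) - (t : ℕ)) r *
        E (a + (b : ℕ) - (t : ℕ) - (r : ℕ))) := by
  have h3 : 1 - q * (x * q ^ M) = 1 - q ^ M * q * x := by ring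
  rw [pow_succ] at h2
  simp only [Fin.sum_univ_two, unfusedR_apply, rowWeight, lastCoeff, h3]
  have hA : q ^ a ≠ 0 := zpow_ne_zero a hq
  have hQ : q ^ M ≠ 0 := pow_ne_zero M hq
  fin_cases r <;> fin_cases b <;> fin_cases t <;> simp
  all_goals try refine Or.inl ?_
  all_goals
    simp only [zpow_add₀ hq, zpow_sub₀ hq, zpow_natCast, zpow_one, pow_succ]
    generalize q ^ M = Q at *
    generalize q ^ a = A at *
    have h1' : 1 - x * Q ≠ 0 := by rwa [mul_comm]
    have h2' : 1 - Q * x * q ≠ 0 := by convert h2 using 2; ring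
    have h2'' : 1 - x * Q * q ≠ 0 := by convert h2 using 2; ring
    field_simp
    try ring

section

variable {ι : Type*} [Fintype ι] [DecidableEq ι]

/-- The ordered product of the `R` matrices along the row `j`. -/
def rowOp (q x : ℂ) {M : ℕ} (f : Fin M → ι) (j : ι) : Matrix (ι → Fin 2) (ι → Fin 2) ℂ :=
  ((List.finRange M).map fun b : Fin M => actOn (unfusedR q (x * q ^ (b : ℕ))) (f b) j).prod

theorem rowOp_succ (q x : ℂ) {M : ℕ} (f : Fin (M + 1) → ι) (j : ι) :
    rowOp q x f j = rowOp q x (f ∘ Fin.castSucc) j *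
      actOn (unfusedR q (x * q ^ M)) (f (Fin.last M)) j := by
  simp [rowOp, List.finRange_succ_last, Function.comp_def]

/-- Induction on the number of columns, the last of which acts first. The spectator `h` must be
arbitrary: after that column has acted, its coordinate and the horizontal one are absorbed into a
new spectator for the shorter row. -/
theorem rowOp_mulVec (q x : ℂ) (hq : q ≠ 0) {M : ℕ} (hx : ∀ k ≤ M, 1 - q ^ k * x ≠ 0)
    (f : Fin M → ι) (hf : Function.Injective f) (j : ι) (hj : ∀ k, f k ≠ j) (a : ℤ)
    (h : (ι → Fin 2) → ℂ) (hh : ∀ σ k s, h (Function.update σ (f k) s) = h σ) :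
    (rowOp q x f j).mulVec (fun σ => exch q a (σ ∘ f) * h σ) = fun τ =>
      ∑ b : Fin 2, rowWeight q M x a b (τ j) *
        (exch q (a + (b : ℕ) - (τ j : ℕ)) (τ ∘ f) * h (Function.update τ j b)) := by
  induction M generalizing a h with
  | zero =>
    funext τ
    have hx0 : 1 - x ≠ 0 := by simpa using hx 0 le_rfl
    have hτ : h (Function.update τ j (τ j)) = h τ := by simp
    have hn : numArrows (τ ∘ f) = 0 := by simp [numArrows]
    simp only [rowOp, List.finRange_zero, List.map_nil, List.prod_nil, Matrix.one_mulVec, exch, hn,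
      Fin.sum_univ_two, rowWeight]
    generalize τ j = t at *
    by_cases ha : a = 0
    · subst ha
      fin_cases t <;> simp at hτ ⊢ <;> rw [hτ] <;> field_simp
    -- Without columns, a term with `a ≠ 0` can survive only for `a = -1` (arrow in, none out) or `a
    -- = 1` (none in, arrow out), and there `rowWeight` contains the factor `1 - q ^ 0`.
    · fin_cases t <;> simp [Ne.symm ha] <;> intro h0
      · simp [← h0]
      · have : a = 1 := by omega
        simp [this]
  | succ M ih =>
    have hst := fun (h' : (ι → Fin 2) → ℂ) hh' a' => ih (fun k hk => hx k (by omega)) (f ∘ Fin.castSucc)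
      (hf.comp (Fin.castSucc_injective M)) (fun k => hj _) a' h' hh'
    rw [rowOp_succ, ← Matrix.mulVec_mulVec]
    have hi : f (Fin.last M) ≠ j := hj _
    have key : (actOn (unfusedR q (x * q ^ M)) (f (Fin.last M)) j).mulVec
        (fun σ => exch q a (σ ∘ f) * h σ) = ∑ s : Fin 2, fun τ =>
          exch q (a - (s : ℕ)) (τ ∘ (f ∘ Fin.castSucc)) * (lastCoeff q a s * ∑ b : Fin 2,
            unfusedR q (x * q ^ M) (τ (f (Fin.last M)), τ j) (s, b) * h (Function.update τ j b)) := by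
      funext τ
      rw [actOn_mulVec _ hi, Finset.sum_apply]
      refine Finset.sum_congr rfl fun s _ => ?_
      simp only [Finset.mul_sum]
      refine Finset.sum_congr rfl fun b _ => ?_
      rw [exch_castSucc, Function.update_comm hi, hh]
      have e1 : (Function.update (Function.update τ j b) (f (Fin.last M)) s ∘ f) (Fin.last M) = s := by
        simp
      have e2 : (Function.update (Function.update τ j b) (f (Fin.last M)) s ∘ f) ∘ Fin.castSucc =
          τ ∘ (f ∘ Fin.castSucc) := by
        funext k
        have : f k.castSucc ≠ f (Fin.last M) := hf.ne (Fin.castSucc_lt_last k).ne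
        simp [this, hj]
      rw [e1, e2]
      ring
    rw [key, Matrix.mulVec_sum]
    funext τ
    rw [Finset.sum_apply]
    have h3 : ∀ s : Fin 2, _ := fun s => congrFun (hst (fun τ => lastCoeff q a s * ∑ b : Fin 2,
            unfusedR q (x * q ^ M) (τ (f (Fin.last M)), τ j) (s, b) * h (Function.update τ j b))
        (by
          intro σ k s'
          have n1 : f (Fin.last M) ≠ f k.castSucc := hf.ne (Fin.castSucc_lt_last k).ne'
          have n2 : f k.castSucc ≠ j := hj _
          simp only [Function.comp, Function.update_of_ne n1, Function.update_of_ne n2.symm,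
            Function.update_comm n2, hh]) (a - (s : ℕ))) τ
    rw [Finset.sum_congr rfl fun s _ => h3 s]
    simp only [Function.update_idem, Function.update_self, Function.update_of_ne hi, Finset.mul_sum]
    rw [Finset.sum_congr rfl fun s _ => Finset.sum_comm, Finset.sum_comm]
    refine Finset.sum_congr rfl fun b _ => ?_
    have := rowWeight_succ q hq M x (hx M (by omega)) (hx (M + 1) le_rfl) a (τ (f (Fin.last M))) b
      (τ j) (fun n => exch q n (τ ∘ (f ∘ Fin.castSucc)))
    rw [exch_castSucc, ← mul_assoc]
    have e3 : ((τ ∘ f) ∘ Fin.castSucc) = τ ∘ (f ∘ Fin.castSucc) := rfl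
    rw [e3]
    simp only [Function.comp_apply (g := f)]
    rw [← this, Finset.sum_mul]
    refine Finset.sum_congr rfl fun s _ => ?_
    rw [Finset.sum_mul]
    refine Finset.sum_congr rfl fun b' _ => ?_
    ring

/-! ### Stacks of rows -/

/-- The ordered product of the `R` matrices over all rows. -/
def stackOp (q x : ℂ) {M L : ℕ} (f : Fin M → ι) (g : Fin L → ι) :
    Matrix (ι → Fin 2) (ι → Fin 2) ℂ :=
  ((List.finRange L).reverse.map fun a : Fin L => rowOp q (x * q ^ (-((a : ℕ) : ℤ))) f (g a)).prod

theorem stackOp_succ (q x : ℂ) (hq : q ≠ 0) {M L : ℕ} (f : Fin M → ι) (g : Fin (L + 1) → ι) :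
    stackOp q x f g = stackOp q (x / q) f (g ∘ Fin.succ) * rowOp q x f (g 0) := by
  have : ∀ k : ℕ, x * q ^ (-((k + 1 : ℕ) : ℤ)) = x / q * q ^ (-(k : ℤ)) := fun k => by
    rw [Nat.cast_add, neg_add, zpow_add₀ hq]
    simp
    ring
  simp only [stackOp, List.finRange_succ, List.reverse_cons, List.map_append, List.prod_append,
    List.map_cons, List.map_nil, List.prod_cons, List.prod_nil, mul_one, ← List.map_reverse,
    List.map_map, Function.comp_def, Fin.val_succ, this]
  simp

/-- The weight with which a stack of `L` rows maps exchangeable vectors with `a` vertical and `b`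
horizontal arrows to the horizontal configuration `δ`. -/
def stackWeight (q : ℂ) (M : ℕ) : (L : ℕ) → ℂ → ℤ → ℤ → (Fin L → Fin 2) → ℂ
  | 0, _, _, b, _ => if b = 0 then 1 else 0
  | L + 1, x, a, b, δ => ∑ b' : Fin 2, firstCoeff q L b b' * rowWeight q M x a b' (δ 0) *
      stackWeight q M L (x / q) (a + (b' : ℕ) - (δ 0 : ℕ)) (b - (b' : ℕ)) (δ ∘ Fin.succ)

theorem generic_div {q x : ℂ} (hq : q ≠ 0) {M L : ℕ}
    (hx : ∀ k : ℤ, -((L + 1 : ℕ) : ℤ) ≤ k → k ≤ M → 1 - q ^ k * x ≠ 0) :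
    ∀ k : ℤ, -(L : ℤ) ≤ k → k ≤ M → 1 - q ^ k * (x / q) ≠ 0 := by
  intro k h1 h2
  convert hx (k - 1) (by push_cast; omega) (by omega) using 2
  rw [zpow_sub₀ hq, zpow_one]
  ring

/-- Row `0` acts first and consumes the first factor of the horizontal vector; the vertical output
and the remaining horizontal factors are again exchangeable, so the induction hypothesis applies at
`x / q`. -/
theorem stackOp_mulVec (q x : ℂ) (hq : q ≠ 0) {M L : ℕ}
    (hx : ∀ k : ℤ, -(L : ℤ) ≤ k → k ≤ M → 1 - q ^ k * x ≠ 0)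
    (f : Fin M → ι) (hf : Function.Injective f) (g : Fin L → ι) (hg : Function.Injective g)
    (hfg : ∀ k l, f k ≠ g l) (a b : ℤ)
    (h : (ι → Fin 2) → ℂ) (hhf : ∀ σ k s, h (Function.update σ (f k) s) = h σ)
    (hhg : ∀ σ k s, h (Function.update σ (g k) s) = h σ) :
    (stackOp q x f g).mulVec (fun σ => exch q a (σ ∘ f) * (exch q b (σ ∘ g) * h σ)) = fun τ =>
      stackWeight q M L x a b (τ ∘ g) *
        (exch q (a + b - numArrows (τ ∘ g)) (τ ∘ f) * h τ) := by
  induction L generalizing x a b h with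
  | zero =>
    funext τ
    have hn : numArrows (τ ∘ g) = 0 := by simp [numArrows]
    have hi : inv (τ ∘ g) = 0 := by simp [inv]
    simp only [stackOp, List.finRange_zero, List.reverse_nil, List.map_nil, List.prod_nil,
      Matrix.one_mulVec, stackWeight, hn]
    by_cases hb : b = 0
    · subst hb; simp [exch, hn, hi]
    · simp [exch, hn, hb, Ne.symm hb]
  | succ L ih =>
    rw [stackOp_succ q x hq, ← Matrix.mulVec_mulVec,
      rowOp_mulVec q x hq (fun k hk => by
        have := hx k (by omega) (by exact_mod_cast hk)
        rwa [zpow_natCast] at this) f hf (g 0) (fun k => hfg k 0)]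
    -- The arrow count of the vertical vector depends on the outgoing value at `g 0`. Summing over
    -- that value `t`, with its indicator placed in the spectator, makes the count constant in each
    -- summand; the later rows do not touch `g 0`.
    · have key : (fun τ => ∑ b' : Fin 2, rowWeight q M x a b' (τ (g 0)) *
          (exch q (a + (b' : ℕ) - (τ (g 0) : ℕ)) (τ ∘ f) *
            (exch q b (Function.update τ (g 0) b' ∘ g) * h (Function.update τ (g 0) b')))) =
          ∑ b' : Fin 2, ∑ t : Fin 2, fun τ => exch q (a + (b' : ℕ) - (t : ℕ)) (τ ∘ f) *
            (exch q (b - (b' : ℕ)) (τ ∘ (g ∘ Fin.succ)) *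
              (firstCoeff q L b b' * rowWeight q M x a b' t *
                ((if τ (g 0) = t then 1 else 0) * h τ))) := by
        funext τ
        simp only [Finset.sum_apply]
        refine Finset.sum_congr rfl fun b' _ => ?_
        rw [Finset.sum_eq_single (τ (g 0)) (fun t _ ht => by simp [Ne.symm ht]) (by simp),
          exch_succ q hq, hhg]
        have e1 : (Function.update τ (g 0) b' ∘ g) 0 = b' := by simp
        have e2 : (Function.update τ (g 0) b' ∘ g) ∘ Fin.succ = τ ∘ (g ∘ Fin.succ) := by
          funext k
          simp [hg.ne (Fin.succ_ne_zero k)]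
        rw [e1, e2, if_pos rfl]
        ring
      have step := fun (a b : ℤ) h hhf hhg => ih (x / q) (generic_div hq hx) (g ∘ Fin.succ)
        (hg.comp (Fin.succ_injective L)) (fun k l => hfg k _) a b h hhf hhg
      rw [key, Matrix.mulVec_sum]
      simp only [Matrix.mulVec_sum]
      funext τ
      simp only [Finset.sum_apply, stackWeight, Finset.sum_mul]
      refine Finset.sum_congr rfl fun b' _ => ?_
      have h3 : ∀ t : Fin 2, _ := fun t => congrFun (step (a + (b' : ℕ) - (t : ℕ)) (b - (b' : ℕ))
        (fun τ => firstCoeff q L b b' * rowWeight q M x a b' t *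
                ((if τ (g 0) = t then 1 else 0) * h τ))
        (fun σ k s => by simp only [hhf, Function.update_of_ne (hfg k 0).symm])
        (fun σ k s => by
          simp only [Function.comp, hhg, Function.update_of_ne (hg.ne (Fin.succ_ne_zero k).symm)])) τ
      rw [Finset.sum_congr rfl fun t _ => h3 t,
        Finset.sum_eq_single (τ (g 0)) (fun t _ ht => by simp [Ne.symm ht]) (by simp), if_pos rfl,
        numArrows_succ]
      simp only [Function.comp_apply, Function.comp_assoc]
      have e4 : a + (b' : ℕ) - (τ (g 0) : ℕ) + (b - (b' : ℕ)) - numArrows (τ ∘ g ∘ Fin.succ) =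
          a + b - (((τ (g 0) : ℕ) + numArrows (τ ∘ g ∘ Fin.succ) : ℕ) : ℤ) := by
        push_cast; ring
      rw [e4]
      ring
    · intro σ k s
      rw [hhf]
      congr 2
      funext l
      simp [Function.update_of_ne (hfg k l).symm]

end

/-! ### Pochhammer symbols and `q`-binomial coefficients -/

theorem qPoch_zero (s x : ℂ) : qPoch s x 0 = 1 := by simp [qPoch]

theorem qPoch_succ (s x : ℂ) (n : ℕ) : qPoch s x (n + 1) = qPoch s x n * (1 - s ^ n * x) := by
  simp [qPoch, Finset.prod_range_succ]

theorem qPoch_succ' (s x : ℂ) (n : ℕ) : qPoch s x (n + 1) = (1 - x) * qPoch s (s * x) n := by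
  rw [qPoch, Finset.prod_range_succ', pow_zero, one_mul, mul_comm]
  congr 1
  exact Finset.prod_congr rfl fun k _ => by ring

theorem qPoch_ne_zero {s x : ℂ} {n : ℕ} (h : ∀ k < n, 1 - s ^ k * x ≠ 0) : qPoch s x n ≠ 0 :=
  Finset.prod_ne_zero_iff.2 fun k hk => h k (Finset.mem_range.1 hk)

/-- The sum of the coefficients of an exchangeable vector, a `q`-binomial coefficient. -/
def qBinom (q : ℂ) (M : ℕ) (a : ℤ) : ℂ := ∑ σ : Fin M → Fin 2, exch q a σ

theorem Zq_eq_qBinom (q : ℂ) (M a : ℕ) : Zq M q a = qBinom q M a := by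
  simp [Zq, qBinom, exch]

theorem qBinom_of_neg (q : ℂ) (M : ℕ) {a : ℤ} (ha : a < 0) : qBinom q M a = 0 :=
  Finset.sum_eq_zero fun σ _ => if_neg (by omega)

theorem qBinom_succ_last (q : ℂ) (M : ℕ) (a : ℤ) :
    qBinom q (M + 1) a = q ^ a * qBinom q M a + qBinom q M (a - 1) := by
  have h := fun (s : Fin 2) (σ : Fin M → Fin 2) => exch_castSucc q a (Fin.snoc σ s : Fin (M + 1) → Fin 2)
  have h' : ∀ (s : Fin 2) (σ : Fin M → Fin 2), (Fin.snoc σ s : Fin (M + 1) → Fin 2) ∘ Fin.castSucc = σ :=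
    fun s σ => by funext k; simp
  rw [qBinom, ← (Fin.snocEquiv fun _ => Fin 2).sum_comp, Fintype.sum_prod_type]
  simp only [Fin.snocEquiv, Equiv.coe_fn_mk, h, h', Fin.snoc_last, ← Finset.mul_sum]
  simp [lastCoeff, qBinom]

theorem qBinom_succ_first (q : ℂ) (hq : q ≠ 0) (M : ℕ) (a : ℤ) :
    qBinom q (M + 1) a = qBinom q M a + q ^ (M + 1 - a) * qBinom q M (a - 1) := by
  have h := fun (s : Fin 2) (σ : Fin M → Fin 2) => exch_succ q hq a (Fin.cons s σ : Fin (M + 1) → Fin 2)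
  have h' : ∀ (s : Fin 2) (σ : Fin M → Fin 2), (Fin.cons s σ : Fin (M + 1) → Fin 2) ∘ Fin.succ = σ :=
    fun s σ => by funext k; simp
  rw [qBinom, ← (Fin.consEquiv fun _ => Fin 2).sum_comp, Fintype.sum_prod_type]
  simp only [Fin.consEquiv, Equiv.coe_fn_mk, h, h', Fin.cons_zero, ← Finset.mul_sum]
  simp [firstCoeff, qBinom]

/-- The difference of the two Pascal rules, obtained by splitting off the last and the first factor.
-/
theorem qBinom_step (q : ℂ) (hq : q ≠ 0) (M : ℕ) (a : ℤ) :
    (1 - q ^ a) * qBinom q M a = (1 - q ^ (M + 1 - a)) * qBinom q M (a - 1) := by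
  linear_combination qBinom_succ_last q M a - qBinom_succ_first q hq M a

theorem qBinom_zero (q : ℂ) (M : ℕ) : qBinom q M 0 = 1 := by
  induction M with
  | zero => simp [qBinom, exch, numArrows, inv]
  | succ M ih => rw [qBinom_succ_last, ih, qBinom_of_neg q M (by norm_num)]; simp

theorem qBinom_mul_qPoch (q : ℂ) (hq : q ≠ 0) (M b : ℕ) :
    qBinom q M b * qPoch q q b = qPoch q⁻¹ (q ^ M) b := by
  induction b with
  | zero => simp [qBinom_zero, qPoch_zero]
  | succ b ih =>
    rw [qPoch_succ, qPoch_succ, ← ih]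
    have := qBinom_step q hq M ((b + 1 : ℕ) : ℤ)
    have e1 : (((b + 1 : ℕ) : ℤ) - 1) = b := by push_cast; ring
    have e2 : q ^ ((M : ℤ) + 1 - ((b + 1 : ℕ) : ℤ)) = q⁻¹ ^ b * q ^ M := by
      have : (M : ℤ) + 1 - ((b + 1 : ℕ) : ℤ) = -(b : ℤ) + M := by push_cast; ring
      rw [this, zpow_add₀ hq, zpow_neg, zpow_natCast, zpow_natCast, inv_pow]
    rw [e1, e2, zpow_natCast] at this
    rw [← pow_succ]
    linear_combination qPoch q q b * this

/-- The ratio of the `q⁻¹`- and `q`-factorials. -/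
def factRatio (q : ℂ) (n : ℕ) : ℂ := ∏ k ∈ Finset.range n, -(q⁻¹ ^ (k + 1))

theorem factRatio_succ (q : ℂ) (n : ℕ) :
    factRatio q (n + 1) = factRatio q n * -(q⁻¹ ^ (n + 1)) := Finset.prod_range_succ _ _

theorem qPoch_inv_self {q : ℂ} (hq : q ≠ 0) (n : ℕ) :
    qPoch q⁻¹ q⁻¹ n = factRatio q n * qPoch q q n := by
  rw [qPoch, factRatio, qPoch, ← Finset.prod_mul_distrib]
  refine Finset.prod_congr rfl fun k _ => ?_
  rw [← pow_succ, ← pow_succ, inv_pow]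
  have := pow_ne_zero (k + 1) hq
  field_simp
  ring

theorem qPoch_shift (s x : ℂ) (n : ℕ) :
    (1 - x) * qPoch s (s * x) n = qPoch s x n * (1 - s ^ n * x) := by
  rw [← qPoch_succ, qPoch_succ']

/-! ### The summands of the closed form and their recursion -/

/-- The elementary factors of the summands of the weight of a stack of `L` rows, as functions of
`y = q ^ L / x`. -/
def stackCoeff (q : ℂ) (M : ℕ) (y x : ℂ) (p m n d : ℕ) : ℂ :=
  (q ^ M / y) ^ d * y ^ m * factRatio q (p + m) / factRatio q d *
    (qPoch q⁻¹ y p * qPoch q⁻¹ x m / (qPoch q⁻¹ q⁻¹ p * qPoch q⁻¹ q⁻¹ m)) *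
    (qPoch q⁻¹ (q ^ M / y) n * qPoch q⁻¹ q⁻¹ (n + d) /
      (qPoch q⁻¹ (q ^ M * x) (n + d) * qPoch q⁻¹ q⁻¹ n))

/-- The summands of the weight of a stack of `L` rows, as functions of `y = q ^ L / x`. -/
def stackTerm (q : ℂ) (M : ℕ) (y x : ℂ) (p m n d : ℕ) : ℂ :=
  stackCoeff q M y x p m n d * qBinom q M (n + d - m)

section

variable (q : ℂ) (M : ℕ) (y x : ℂ) (p m n d : ℕ)

theorem inv_qPoch_shift (hx : 1 - q ^ M * x ≠ 0)
    (hP : qPoch q⁻¹ (q ^ M * x) n ≠ 0) (hP' : qPoch q⁻¹ (q ^ M * (x / q)) n ≠ 0) :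
    (qPoch q⁻¹ (q ^ M * x) n)⁻¹ = (1 - q⁻¹ ^ n * (q ^ M * x)) * (1 - q ^ M * x)⁻¹ *
      (qPoch q⁻¹ (q ^ M * (x / q)) n)⁻¹ := by
  have e : q ^ M * (x / q) = q⁻¹ * (q ^ M * x) := by ring
  have h := qPoch_shift q⁻¹ (q ^ M * x) n
  rw [← e] at h
  generalize qPoch q⁻¹ (q ^ M * (x / q)) n = A at *
  generalize qPoch q⁻¹ (q ^ M * x) n = B at *
  generalize q⁻¹ ^ n * (q ^ M * x) = C at *
  generalize q ^ M * x = D at *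
  field_simp
  linear_combination h

theorem inv_qPoch_succ :
    (qPoch q⁻¹ (q ^ M * x) (n + 1))⁻¹ = (1 - q ^ M * x)⁻¹ *
      (qPoch q⁻¹ (q ^ M * (x / q)) n)⁻¹ := by
  have e : q⁻¹ * (q ^ M * x) = q ^ M * (x / q) := by ring
  rw [qPoch_succ', mul_inv, e]

/-- This and the next four lemmas give ratios to coefficients at `x / q` with the same `y`. Only the
symbols in `x` and `q ^ M * x` see the shift, and they change by boundary factors. -/
theorem stackCoeff_zero (hx : 1 - q ^ M * x ≠ 0) (hP : qPoch q⁻¹ (q ^ M * x) (n + d) ≠ 0)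
    (hP' : qPoch q⁻¹ (q ^ M * (x / q)) (n + d) ≠ 0) :
    stackCoeff q M y x p 0 n d = stackCoeff q M y (x / q) p 0 n d *
      ((1 - q⁻¹ ^ (n + d) * (q ^ M * x)) / (1 - q ^ M * x)) := by
  simp only [stackCoeff, div_eq_mul_inv, mul_inv, qPoch_zero] at *
  rw [inv_qPoch_shift q M x (n + d) hx hP hP']
  simp only [div_eq_mul_inv]
  ring

theorem stackCoeff_succ (hx : 1 - q ^ M * x ≠ 0) (hP : qPoch q⁻¹ (q ^ M * x) (n + d) ≠ 0)
    (hP' : qPoch q⁻¹ (q ^ M * (x / q)) (n + d) ≠ 0) :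
    stackCoeff q M y x p (m + 1) n d = stackCoeff q M y (x / q) p m n d *
      (-(y * q⁻¹ ^ (p + m + 1)) * (1 - x) / (1 - q⁻¹ ^ (m + 1)) *
      ((1 - q⁻¹ ^ (n + d) * (q ^ M * x)) / (1 - q ^ M * x))) := by
  have e : x / q = q⁻¹ * x := by ring
  simp only [stackCoeff, qPoch_succ q⁻¹ q⁻¹ m, qPoch_succ' q⁻¹ x m, ← e, div_eq_mul_inv _ (_ * _), mul_inv,
    inv_qPoch_shift q M x (n + d) hx hP hP', ← add_assoc, factRatio_succ, pow_succ]
  ring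

theorem stackCoeff_div_succ :
    stackCoeff q M y (x / q) p (m + 1) n d = stackCoeff q M y (x / q) p m n d *
      (-(y * q⁻¹ ^ (p + m + 1)) * (1 - q⁻¹ ^ (m + 1) * x) / (1 - q⁻¹ ^ (m + 1))) := by
  simp only [stackCoeff, qPoch_succ _ _ m, div_eq_mul_inv _ (_ * _), mul_inv, ← add_assoc,
    factRatio_succ, pow_succ]
  ring

theorem stackCoeff_zero_succ :
    stackCoeff q M y x p 0 n (d + 1) = stackCoeff q M y (x / q) p 0 n d *
      ((q ^ M / y) / -(q⁻¹ ^ (d + 1)) * (1 - q⁻¹ ^ (n + d + 1)) / (1 - q ^ M * x)) := by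
  simp only [stackCoeff, qPoch_zero, ← add_assoc, qPoch_succ q⁻¹ q⁻¹ (n + d), div_eq_mul_inv _ (_ * _),
    mul_inv, inv_qPoch_succ, factRatio_succ, pow_succ]
  ring

theorem stackCoeff_succ_succ :
    stackCoeff q M y x p (m + 1) n (d + 1) = stackCoeff q M y (x / q) p m n d *
      (-(y * q⁻¹ ^ (p + m + 1)) * (1 - x) / (1 - q⁻¹ ^ (m + 1)) *
      ((q ^ M / y) / -(q⁻¹ ^ (d + 1)) * (1 - q⁻¹ ^ (n + d + 1)) / (1 - q ^ M * x))) := by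
  have e : x / q = q⁻¹ * x := by ring
  simp only [stackCoeff, qPoch_succ q⁻¹ q⁻¹ m, qPoch_succ' q⁻¹ x m, ← e, ← add_assoc,
    qPoch_succ q⁻¹ q⁻¹ (n + d), div_eq_mul_inv _ (_ * _),
    mul_inv, inv_qPoch_succ, factRatio_succ, pow_succ]
  ring

end

section

variable (q : ℂ) (M : ℕ) (y x : ℂ) (p m n d : ℕ)

theorem zpow_sub_add {q : ℂ} (hq : q ≠ 0) (M m n d : ℕ) :
    q ^ ((M : ℤ) - (n + d - m)) = q ^ M * q ^ m * (q⁻¹ ^ n * q⁻¹ ^ d) := by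
  simp only [zpow_sub₀ hq, zpow_add₀ hq, zpow_natCast, inv_pow]
  field_simp

/-- The four `stackTerm` recursions are the row recursion for a single `p`, according to the arrow
leaving the first row (0 or 1) and to whether `m = b - p` is 0 or positive. For `m = 0` no arrow may
enter that row, so one term is missing. -/
theorem stackTerm_zero_zero (hq : q ≠ 0) (hx : 1 - q ^ M * x ≠ 0)
    (hP : qPoch q⁻¹ (q ^ M * x) (n + d) ≠ 0)
    (hP' : qPoch q⁻¹ (q ^ M * (x / q)) (n + d) ≠ 0) :
    stackTerm q M y x p 0 n d =
      rowWeight q M x (n + d - (0 : ℕ)) 0 0 * stackTerm q M y (x / q) p 0 n d := by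
  simp only [stackTerm, stackCoeff_zero q M y x p n d hx hP hP', rowWeight, Matrix.of_apply,
    Matrix.cons_val_zero, zpow_sub_add hq]
  ring

theorem stackTerm_zero_succ (hq : q ≠ 0) (hm : 1 - q⁻¹ ^ (m + 1) ≠ 0) (hx : 1 - q ^ M * x ≠ 0)
    (hP : qPoch q⁻¹ (q ^ M * x) (n + d) ≠ 0)
    (hP' : qPoch q⁻¹ (q ^ M * (x / q)) (n + d) ≠ 0) :
    stackTerm q M y x p (m + 1) n d =
      rowWeight q M x (n + d - (m + 1 : ℕ)) 0 0 * stackTerm q M y (x / q) p (m + 1) n d +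
      y * x * q⁻¹ ^ (p + m + 1) * rowWeight q M x (n + d - (m + 1 : ℕ)) 1 0 *
        stackTerm q M y (x / q) p m n d := by
  have hz := qBinom_step q hq M (n + d - m)
  have e1 : (n : ℤ) + d - m - 1 = n + d - (m + 1 : ℕ) := by push_cast; ring
  have e2 : (n : ℤ) + d - (m + 1 : ℕ) + 1 = n + d - m := by push_cast; ring
  have e3 : (M : ℤ) + 1 - (n + d - m) = M - (n + d - (m + 1 : ℕ)) := by push_cast; ring
  rw [e1, e3, zpow_sub_add hq] at hz
  have hS : q ^ (m + 1) = (q⁻¹ ^ (m + 1))⁻¹ := by rw [inv_pow, inv_inv]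
  have hS0 : q⁻¹ ^ (m + 1) ≠ 0 := pow_ne_zero _ (inv_ne_zero hq)
  have hx' : 1 - x * q ^ M ≠ 0 := by rwa [mul_comm]
  rw [hS] at hz
  simp only [stackTerm, stackCoeff_succ q M y x p m n d hx hP hP', stackCoeff_div_succ, rowWeight,
    Matrix.of_apply, Matrix.cons_val_zero, Matrix.cons_val_one, zpow_sub_add hq, e2, pow_add _ n d, hS]
  generalize q⁻¹ ^ (m + 1) = S at *
  generalize q⁻¹ ^ (p + m + 1) = E at *
  generalize q⁻¹ ^ n * q⁻¹ ^ d = V at *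
  generalize q ^ ((n : ℤ) + d - m) = A at *
  generalize stackCoeff q M y (x / q) p m n d = C at *
  generalize qBinom q M (n + d - m) = B at *
  generalize qBinom q M (n + d - (m + 1 : ℕ)) = B' at *
  generalize q ^ M = W at *
  -- The product `(1 - W * S⁻¹ * V) * B'` is isolated so that `hz` can replace it as a whole:
  -- neighbouring binomials are related without dividing by factors that may vanish.
  have key : C * (-(y * E) * (1 - x) / (1 - S) * ((1 - V * (W * x)) / (1 - W * x))) * B' =
      (1 - W * S⁻¹ * V * x) / (1 - W * x) * (C * (-(y * E) * (1 - S * x) / (1 - S)) * B') +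
      y * x * E * C / (1 - W * x) * ((1 - W * S⁻¹ * V) * B') := by
    field_simp
    ring
  rw [key, ← hz]
  ring

theorem stackTerm_one_zero (hq : q ≠ 0) (hy : y ≠ 0) :
    y * x * q⁻¹ ^ (d + 1) * stackTerm q M y x p 0 n (d + 1) =
      rowWeight q M x (n + (d + 1 : ℕ) - (0 : ℕ)) 0 1 * stackTerm q M y (x / q) p 0 n d := by
  have hz := qBinom_step q hq M (n + (d + 1 : ℕ) - (0 : ℕ))
  have e1 : (n : ℤ) + (d + 1 : ℕ) - (0 : ℕ) - 1 = n + d - (0 : ℕ) := by push_cast; ring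
  have e3 : (M : ℤ) + 1 - (n + (d + 1 : ℕ) - (0 : ℕ)) = M - (n + (d + 1 : ℕ) - (0 : ℕ)) + 1 := by ring
  rw [e1, e3] at hz
  have e4 : q ^ ((n : ℤ) + (d + 1 : ℕ) - (0 : ℕ)) = (q⁻¹ ^ (n + d + 1))⁻¹ := by
    rw [inv_pow, inv_inv, ← zpow_natCast]
    congr 1
  have e5 : q⁻¹ ^ n * q⁻¹ ^ (d + 1) = q⁻¹ ^ (n + d + 1) := by ring
  have hs : q⁻¹ ^ (d + 1) ≠ 0 := pow_ne_zero _ (inv_ne_zero hq)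
  have ht : q⁻¹ ^ (n + d + 1) ≠ 0 := pow_ne_zero _ (inv_ne_zero hq)
  rw [e4] at hz
  simp only [stackTerm, stackCoeff_zero_succ, rowWeight, Matrix.of_apply, Matrix.cons_val_zero,
    Matrix.cons_val_one, zpow_sub_add hq, e5]
  generalize q ^ ((M : ℤ) - (n + (d + 1 : ℕ) - (0 : ℕ)) + 1) = A at *
  generalize q⁻¹ ^ (n + d + 1) = V at *
  generalize q⁻¹ ^ (d + 1) = D at *
  generalize stackCoeff q M y (x / q) p 0 n d = C at *
  generalize qBinom q M (n + d - (0 : ℕ)) = B at *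
  generalize qBinom q M (n + (d + 1 : ℕ) - (0 : ℕ)) = B' at *
  generalize q ^ M = W at *
  have key : y * x * D * (C * (W / y / -D * (1 - V) / (1 - W * x)) * B') =
      x * W * V * C / (1 - W * x) * ((1 - V⁻¹) * B') := by
    field_simp
    ring
  rw [key, hz]
  ring

theorem stackTerm_one_succ (hq : q ≠ 0) (hy : y ≠ 0) (hm : 1 - q⁻¹ ^ (m + 1) ≠ 0)
    (hx : 1 - q ^ M * x ≠ 0) :
    y * x * q⁻¹ ^ (d + 1) * stackTerm q M y x p (m + 1) n (d + 1) =
      rowWeight q M x (n + (d + 1 : ℕ) - (m + 1 : ℕ)) 0 1 * stackTerm q M y (x / q) p (m + 1) n d +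
      y * x * q⁻¹ ^ (p + m + 1) * rowWeight q M x (n + (d + 1 : ℕ) - (m + 1 : ℕ)) 1 1 *
        stackTerm q M y (x / q) p m n d := by
  have hz := qBinom_step q hq M (n + d - m)
  have e1 : (n : ℤ) + d - m - 1 = n + d - (m + 1 : ℕ) := by push_cast; ring
  have e2 : (n : ℤ) + (d + 1 : ℕ) - (m + 1 : ℕ) = n + d - m := by push_cast; ring
  have e3 : (M : ℤ) + 1 - (n + d - m) = M - (n + d - m) + 1 := by ring
  rw [e1, e3] at hz
  have hT : q⁻¹ ^ (n + d + 1) = q⁻¹ ^ n * q⁻¹ ^ d * q⁻¹ := by ring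
  have hU : q ^ ((n : ℤ) + d - m) = (q⁻¹ ^ (n + d + 1))⁻¹ * q⁻¹ ^ (m + 1) := by
    simp only [zpow_sub₀ hq, zpow_add₀ hq, zpow_natCast, inv_pow, pow_succ, pow_add]
    field_simp
  have hV : q ^ ((M : ℤ) - (n + d - m)) = q ^ M * (q⁻¹ ^ (m + 1))⁻¹ * q⁻¹ ^ (n + d + 1) := by
    rw [zpow_sub_add hq, hT]
    simp only [inv_pow, pow_succ]
    field_simp
  have hs : q⁻¹ ^ (d + 1) ≠ 0 := pow_ne_zero _ (inv_ne_zero hq)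
  have hS : q⁻¹ ^ (m + 1) ≠ 0 := pow_ne_zero _ (inv_ne_zero hq)
  have ht : q⁻¹ ^ (n + d + 1) ≠ 0 := pow_ne_zero _ (inv_ne_zero hq)
  have hx' : 1 - x * q ^ M ≠ 0 := by rwa [mul_comm]
  rw [hU] at hz
  simp only [stackTerm, stackCoeff_succ_succ, stackCoeff_div_succ, rowWeight,
    Matrix.of_apply, Matrix.cons_val_zero, Matrix.cons_val_one, e2, hV]
  generalize q ^ ((M : ℤ) - (n + d - m) + 1) = A at *
  generalize q⁻¹ ^ (m + 1) = S at *
  generalize q⁻¹ ^ (p + m + 1) = E at *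
  generalize q⁻¹ ^ (d + 1) = D at *
  generalize q⁻¹ ^ (n + d + 1) = V at *
  generalize stackCoeff q M y (x / q) p m n d = C at *
  generalize qBinom q M (n + d - m) = B at *
  generalize qBinom q M (n + d - (m + 1 : ℕ)) = B' at *
  generalize q ^ M = W at *
  have key : x * (W * S⁻¹ * V) * (1 - A) / (1 - W * x) *
        (C * (-(y * E) * (1 - S * x) / (1 - S)) * B') =
      x * (W * S⁻¹ * V) / (1 - W * x) *
        (C * (-(y * E) * (1 - S * x) / (1 - S))) * ((1 - A) * B') := by
    ring
  rw [key, ← hz]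
  field_simp
  ring

end

/-! ### The initial condition: a vanishing `q`-Vandermonde sum -/

/-- The full sum is `(x y; s)_b / (s; s)_b`, which vanishes for `x y = 1` and `b > 0`. Stating all
partial sums in product form makes a direct induction possible; at `j = b` the last factor is `1 - s
^ 0`. -/
theorem sum_qPoch_telescope {s x y : ℂ} (hxy : x * y = 1) {b : ℕ}
    (hs : ∀ k, 1 ≤ k → k ≤ b → 1 - s ^ k ≠ 0) {j : ℕ} (hj : j ≤ b) :
    (1 - s ^ b) * ∑ p ∈ Finset.range (j + 1),
        y ^ (b - p) * (qPoch s y p * qPoch s x (b - p) / (qPoch s s p * qPoch s s (b - p))) =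
      y ^ (b - j) * (qPoch s (s * y) j * qPoch s x (b - j) /
        (qPoch s s j * qPoch s s (b - j))) * (1 - s ^ (b - j)) := by
  induction j with
  | zero => simp [qPoch_zero]; ring
  | succ j ih =>
    obtain ⟨k, rfl⟩ : ∃ k, b = j + 1 + k := ⟨b - (j + 1), by omega⟩
    rw [Finset.sum_range_succ, mul_add, ih (by omega)]
    have e1 : j + 1 + k - j = k + 1 := by omega
    have e2 : j + 1 + k - (j + 1) = k := by omega
    have hk := hs (k + 1) (by omega) (by omega)
    have hj' := hs (j + 1) (by omega) (by omega)
    rw [e1, e2, qPoch_succ' s y, qPoch_succ s (s * y), qPoch_succ s x, qPoch_succ s s k,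
      qPoch_succ s s j, ← pow_succ, ← pow_succ, pow_add s (j + 1) k, ← mul_assoc (s ^ j), ← pow_succ]
    generalize s ^ (j + 1) = A at *
    generalize s ^ (k + 1) = B at *
    generalize s ^ k = S at *
    have hx : x ≠ 0 := left_ne_zero_of_mul_eq_one hxy
    have hy : y = x⁻¹ := eq_inv_of_mul_eq_one_right hxy
    have key : y * (1 - S * x) * (1 - A) + (1 - y) * (1 - A * S) = (1 - A * y) * (1 - S) := by
      linear_combination (-S * (1 - A)) * hxy
    have c1 : (1 - B) * (1 - B)⁻¹ = 1 := mul_inv_cancel₀ hk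
    have c2 : (1 - A) * (1 - A)⁻¹ = 1 := mul_inv_cancel₀ hj'
    simp only [div_eq_mul_inv, mul_inv, pow_succ]
    linear_combination (y ^ k * qPoch s (s * y) j * qPoch s x k * (qPoch s s j)⁻¹ *
      (qPoch s s k)⁻¹ * (1 - A)⁻¹) * key +
      (y ^ k * y * qPoch s (s * y) j * qPoch s x k * (1 - S * x) * (qPoch s s j)⁻¹ *
      (qPoch s s k)⁻¹) * (c1 - c2)

theorem sum_range_min {A : Type*} [AddCommMonoid A] (b c : ℕ) (f : ℕ → A) :
    ∑ p ∈ Finset.range (min b c + 1), f p =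
      ∑ p ∈ Finset.range (c + 1), if p ≤ b then f p else 0 := by
  rw [← Finset.sum_filter]
  congr 1
  ext p
  simp only [Finset.mem_range, Finset.mem_filter]
  omega

theorem one_sub_inv_pow_ne_zero {q : ℂ} {k : ℕ} (h : q ^ k ≠ 1) : 1 - q⁻¹ ^ k ≠ 0 := by
  rw [inv_pow, sub_ne_zero]
  exact fun h' => h (inv_eq_one.1 h'.symm)

theorem qPoch_generic_ne_zero {q x : ℂ} (hq : q ≠ 0) {M N : ℕ} (L : ℕ)
    (hx : ∀ k : ℤ, -(L : ℤ) ≤ k → k ≤ M → 1 - q ^ k * x ≠ 0) (hN : N ≤ M + L + 1) :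
    qPoch q⁻¹ (q ^ M * x) N ≠ 0 := by
  refine qPoch_ne_zero fun k hk => ?_
  have := hx (M - k) (by omega) (by omega)
  rw [zpow_sub₀ hq, zpow_natCast, zpow_natCast] at this
  convert this using 2
  rw [inv_pow]
  ring

theorem stackWeight_of_neg (q : ℂ) (M L : ℕ) (x : ℂ) (a : ℤ) {b : ℤ} (hb : b < 0)
    (δ : Fin L → Fin 2) : stackWeight q M L x a b δ = 0 := by
  induction L generalizing x a b with
  | zero => simp [stackWeight, hb.ne]
  | succ L ih =>
    simp only [stackWeight]
    exact Finset.sum_eq_zero fun b' _ => by rw [ih _ _ (by omega), mul_zero]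

/-- At `d = 0` and `y = 1 / x` the factors in `c - p` cancel, leaving the telescoping sum. If `c <
b` the sum is truncated, but then the binomial coefficient at `c - b` is zero. -/
theorem stackTerm_sum_zero (q : ℂ) (hq : q ≠ 0) (M : ℕ) {x : ℂ} (hx0 : x ≠ 0) (b c : ℕ) (hc : c ≤ M)
    (hroot : ∀ k, 1 ≤ k → k ≤ b → q ^ k ≠ 1) (hroot' : ∀ k, 1 ≤ k → k ≤ c → q ^ k ≠ 1)
    (hx : ∀ k : ℤ, 0 ≤ k → k ≤ M → 1 - q ^ k * x ≠ 0) :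
    ∑ p ∈ Finset.range (min b c + 1), stackTerm q M (1 / x) x p (b - p) (c - p) 0 =
      if b = 0 then qBinom q M c else 0 := by
  have hterm : ∀ p ∈ Finset.range (min b c + 1), stackTerm q M (1 / x) x p (b - p) (c - p) 0 =
      factRatio q b * qBinom q M (c - b) * ((1 / x) ^ (b - p) * (qPoch q⁻¹ (1 / x) p *
        qPoch q⁻¹ x (b - p) / (qPoch q⁻¹ q⁻¹ p * qPoch q⁻¹ q⁻¹ (b - p)))) := by
    intro p hp
    have hp' : p ≤ b ∧ p ≤ c := by rw [Finset.mem_range] at hp; omega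
    have e1 : p + (b - p) = b := by omega
    have e2 : ((c - p : ℕ) : ℤ) + (0 : ℕ) - (b - p : ℕ) = c - b := by omega
    have e3 : q ^ M / (1 / x) = q ^ M * x := by rw [div_div_eq_mul_div, div_one]
    have n1 : qPoch q⁻¹ (q ^ M * x) (c - p) ≠ 0 :=
      qPoch_generic_ne_zero hq 0 (by simpa using hx) (by omega)
    have n2 : qPoch q⁻¹ q⁻¹ (c - p) ≠ 0 := qPoch_ne_zero fun k hk => by
      rw [← pow_succ]
      exact one_sub_inv_pow_ne_zero (hroot' _ (by omega) (by omega))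
    rw [stackTerm, stackCoeff, e1, e2, e3, add_zero, div_self (mul_ne_zero n1 n2)]
    simp only [pow_zero, factRatio, Finset.range_zero, Finset.prod_empty]
    ring
  rw [Finset.sum_congr rfl hterm, ← Finset.mul_sum]
  rcases Nat.eq_zero_or_pos b with rfl | hb
  · simp [qPoch_zero, factRatio]
  rw [if_neg hb.ne']
  rcases lt_or_ge c b with h | h
  · rw [qBinom_of_neg q M (by omega)]; simp
  · have := sum_qPoch_telescope (s := q⁻¹) (mul_one_div_cancel hx0) (b := b)
      (fun k h1 h2 => one_sub_inv_pow_ne_zero (hroot k h1 h2)) le_rfl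
    rw [Nat.sub_self, pow_zero (q⁻¹), sub_self, mul_zero, mul_eq_zero] at this
    rw [min_eq_left h, this.resolve_left (one_sub_inv_pow_ne_zero (hroot b hb le_rfl)), mul_zero]

/-! ### Closed form of the stack weights -/

/-- Along the recursion `y`, `c` and `p` stay fixed while `b` drops by the arrow entering the first
row. Hence the sums can be compared term by term in `p`. -/
theorem stackWeight_eq (q : ℂ) (hq : q ≠ 0) (M N c : ℕ) (hc : c ≤ M) (hcN : c ≤ N)
    (hroot : ∀ k, 1 ≤ k → k ≤ N → q ^ k ≠ 1) (L : ℕ) {x : ℂ} (hx0 : x ≠ 0)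
    (hx : ∀ k : ℤ, -(L : ℤ) ≤ k → k ≤ M → 1 - q ^ k * x ≠ 0) (b : ℕ) (hb : b ≤ N)
    (δ : Fin L → Fin 2) :
    qBinom q M c * stackWeight q M L x (c + numArrows δ - b) b δ =
      q ^ inv δ * ∑ p ∈ Finset.range (min b c + 1),
        stackTerm q M (q ^ L / x) x p (b - p) (c - p) (numArrows δ) := by
  induction L generalizing x b with
  | zero =>
    have hn : numArrows δ = 0 := by simp [numArrows]
    have hi : inv δ = 0 := by simp [inv]
    rw [hn, hi, pow_zero, one_mul, stackTerm_sum_zero q hq M hx0 b c hc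
      (fun k h1 h2 => hroot k h1 (by omega)) (fun k h1 h2 => hroot k h1 (by omega))
      (by simpa using hx)]
    simp [stackWeight]
  | succ L ih =>
    have hxq : x / q ≠ 0 := div_ne_zero hx0 hq
    have IH := fun b hb => ih hxq (generic_div hq hx) b hb (δ ∘ Fin.succ)
    have hy : q ^ L / (x / q) = q ^ (L + 1) / x := by rw [div_div_eq_mul_div, pow_succ]
    rw [hy] at IH
    have hy0 : q ^ (L + 1) / x ≠ 0 := div_ne_zero (pow_ne_zero _ hq) hx0
    have hyx : q ^ (L + 1) / x * x = q ^ (L + 1) := div_mul_cancel₀ _ hx0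
    have hMx : 1 - q ^ M * x ≠ 0 := by
      have := hx M (by omega) le_rfl
      rwa [zpow_natCast] at this
    have hd := numArrows_le (δ ∘ Fin.succ)
    have hinv := inv_succ δ
    have hnum := numArrows_succ δ
    have hcoef : ∀ b : ℕ, firstCoeff q L b 1 = q ^ (L + 1) / x * x * q⁻¹ ^ b := fun b => by
      rw [hyx, firstCoeff, if_neg (by decide), zpow_sub₀ hq, zpow_natCast, inv_pow]
      norm_cast
    simp only [stackWeight, Fin.sum_univ_two]
    generalize δ ∘ Fin.succ = δ' at *
    generalize q ^ (L + 1) / x = y at *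
    have hP : ∀ p, qPoch q⁻¹ (q ^ M * x) (c - p + numArrows δ') ≠ 0 := fun p =>
      qPoch_generic_ne_zero hq (L + 1) hx (by omega)
    have hP' : ∀ p, qPoch q⁻¹ (q ^ M * (x / q)) (c - p + numArrows δ') ≠ 0 := fun p =>
      qPoch_generic_ne_zero hq L (generic_div hq hx) (by omega)
    have hfirst : firstCoeff q L b 0 = 1 := if_pos rfl
    -- `κ` is the contribution of the first entry of `δ` to `q ^ inv δ`. It unifies the cases `δ 0 =
    -- 0` and `δ 0 = 1` of the recursion for the summands.
    obtain ⟨κ, hκ, h0, h1⟩ : ∃ κ : ℂ, q ^ inv δ = q ^ inv δ' * κ ∧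
        (∀ p, κ * stackTerm q M y x p 0 (c - p) (numArrows δ) =
          rowWeight q M x ((c - p : ℕ) + numArrows δ - (0 : ℕ)) 0 (δ 0) *
            stackTerm q M y (x / q) p 0 (c - p) (numArrows δ')) ∧
        ∀ p m, m + 1 ≤ N → κ * stackTerm q M y x p (m + 1) (c - p) (numArrows δ) =
          rowWeight q M x ((c - p : ℕ) + numArrows δ - (m + 1 : ℕ)) 0 (δ 0) *
            stackTerm q M y (x / q) p (m + 1) (c - p) (numArrows δ') +
          y * x * q⁻¹ ^ (p + m + 1) *
            rowWeight q M x ((c - p : ℕ) + numArrows δ - (m + 1 : ℕ)) 1 (δ 0) *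
            stackTerm q M y (x / q) p m (c - p) (numArrows δ') := by
      have hm : ∀ m, m + 1 ≤ N → 1 - q⁻¹ ^ (m + 1) ≠ 0 := fun m h =>
        one_sub_inv_pow_ne_zero (hroot _ (by omega) h)
      obtain hδ | hδ : δ 0 = 0 ∨ δ 0 = 1 := by
        generalize δ 0 = s
        fin_cases s <;> simp
      · have hi : inv δ = inv δ' := by simpa [hδ] using hinv
        have hn : numArrows δ = numArrows δ' := by simpa [hδ] using hnum
        rw [hδ, hi, hn]
        refine ⟨1, (mul_one _).symm, fun p => ?_, fun p m h => ?_⟩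
        · rw [one_mul]
          exact stackTerm_zero_zero q M y x p _ _ hq hMx (hP p) (hP' p)
        · rw [one_mul]
          exact stackTerm_zero_succ q M y x p m _ _ hq (hm m h) hMx (hP p) (hP' p)
      · have hi : inv δ + numArrows δ' = inv δ' + L := by simpa [hδ] using hinv
        have hn : numArrows δ = numArrows δ' + 1 := by simpa [hδ, add_comm] using hnum
        rw [hδ, hn]
        -- Since `y * x = q ^ (L + 1)`, this is `q` to the number of zeros of `δ'`, the inversions
        -- created by an initial 1.
        refine ⟨y * x * q⁻¹ ^ (numArrows δ' + 1), ?_, fun p => ?_, fun p m h => ?_⟩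
        · have h2 : inv δ + (numArrows δ' + 1) = inv δ' + (L + 1) := by omega
          have h3 := pow_ne_zero (numArrows δ' + 1) hq
          rw [hyx, inv_pow, ← mul_assoc, ← pow_add, ← h2, pow_add, mul_inv_cancel_right₀ h3]
        · exact stackTerm_one_zero q M y x p _ _ hq hy0
        · exact stackTerm_one_succ q M y x p m _ _ hq hy0 (hm m h) hMx
    -- Summing over `p ≤ c` with an indicator gives the sums for `b` and `b - 1` a common range.
    rw [hfirst, hκ, sum_range_min]
    have hW0 : qBinom q M c * stackWeight q M L (x / q)
        (c + numArrows δ - b + ((0 : Fin 2) : ℕ) - (δ 0 : ℕ)) (b - ((0 : Fin 2) : ℕ)) δ' =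
        q ^ inv δ' * ∑ p ∈ Finset.range (c + 1), if p ≤ b then
          stackTerm q M y (x / q) p (b - p) (c - p) (numArrows δ') else 0 := by
      rw [← sum_range_min, ← IH b hb]
      congr 2
      rw [hnum]
      simp
      ring
    cases b with
    | zero =>
      rw [stackWeight_of_neg q M L (x / q) _ (b := ((0 : ℕ) : ℤ) - ((1 : Fin 2) : ℕ)) (by simp)]
      have hsum : ∀ f : ℕ → ℂ, (∑ p ∈ Finset.range (c + 1), if p ≤ 0 then f p else 0) = f 0 :=
        fun f => by rw [← sum_range_min]; simp
      rw [hsum] at hW0 ⊢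
      have h00 := h0 0
      linear_combination rowWeight q M x (c + numArrows δ - (0 : ℕ)) 0 (δ 0) * hW0 -
        q ^ inv δ' * h00
    | succ B =>
      have hW1 : qBinom q M c * stackWeight q M L (x / q)
          (c + numArrows δ - (B + 1 : ℕ) + ((1 : Fin 2) : ℕ) - (δ 0 : ℕ))
          ((B + 1 : ℕ) - ((1 : Fin 2) : ℕ)) δ' =
          q ^ inv δ' * ∑ p ∈ Finset.range (c + 1), if p ≤ B then
            stackTerm q M y (x / q) p (B - p) (c - p) (numArrows δ') else 0 := by
        rw [← sum_range_min, ← IH B (by omega)]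
        congr 2
        · rw [hnum]; simp; ring
        · simp
      rw [hcoef]
      suffices hsum : κ * (∑ p ∈ Finset.range (c + 1), if p ≤ B + 1 then
            stackTerm q M y x p (B + 1 - p) (c - p) (numArrows δ) else 0) =
          rowWeight q M x (c + numArrows δ - (B + 1 : ℕ)) 0 (δ 0) *
            (∑ p ∈ Finset.range (c + 1), if p ≤ B + 1 then
              stackTerm q M y (x / q) p (B + 1 - p) (c - p) (numArrows δ') else 0) +
          y * x * q⁻¹ ^ (B + 1) * rowWeight q M x (c + numArrows δ - (B + 1 : ℕ)) 1 (δ 0) *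
            ∑ p ∈ Finset.range (c + 1), if p ≤ B then
              stackTerm q M y (x / q) p (B - p) (c - p) (numArrows δ') else 0 by
        linear_combination rowWeight q M x (c + numArrows δ - (B + 1 : ℕ)) 0 (δ 0) * hW0 +
          y * x * q⁻¹ ^ (B + 1) * rowWeight q M x (c + numArrows δ - (B + 1 : ℕ)) 1 (δ 0) * hW1 -
          q ^ inv δ' * hsum
      rw [Finset.mul_sum, Finset.mul_sum, Finset.mul_sum, ← Finset.sum_add_distrib]
      refine Finset.sum_congr rfl fun p hp => ?_
      have hp' : p ≤ c := by rw [Finset.mem_range] at hp; omega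
      -- For `p ≤ B` both incoming values contribute; at `p = B + 1` only the value 0 does, which is
      -- the case `m = 0`.
      rcases lt_trichotomy p (B + 1) with h | rfl | h
      · obtain ⟨m, rfl⟩ : ∃ m, B = p + m := ⟨B - p, by omega⟩
        have e1 : p + m + 1 - p = m + 1 := by omega
        have e2 : p + m - p = m := by omega
        have e3 : ((c - p : ℕ) : ℤ) + numArrows δ - (m + 1 : ℕ) =
          c + numArrows δ - (p + m + 1 : ℕ) := by omega
        rw [if_pos h.le, if_pos h.le, if_pos (Nat.le_add_right p m), e1, e2, h1 p m (by omega), e3]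
      · have e3 : ((c - (B + 1) : ℕ) : ℤ) + numArrows δ - (0 : ℕ) =
          c + numArrows δ - (B + 1 : ℕ) := by omega
        rw [if_pos le_rfl, if_neg (Nat.not_succ_le_self B), if_pos le_rfl, Nat.sub_self, h0, e3]
        ring
      · simp [h.not_ge, show ¬ p ≤ B by omega]

/-! ### From stack weights to the fused matrix -/

theorem fusedROp_eq_stackOp (I : ℕ) (q u : ℂ) (hq : q ≠ 0) :
    fusedROp I q u = stackOp q u (Sum.inl : Fin I → Fin I ⊕ Fin I) Sum.inr := by
  have : ∀ a b : ℕ, u * q ^ ((b : ℤ) - (a : ℤ)) = u * q ^ (-(a : ℤ)) * q ^ b := fun a b => by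
    rw [sub_eq_neg_add, zpow_add₀ hq, zpow_natCast, mul_assoc]
  simp only [fusedROp, stackOp, rowOp, this]

theorem injPi_apply (I : ℕ) (q : ℂ) (σ : Fin I → Fin 2) (a : Fin (I + 1)) :
    injPi I q σ a = exch q (a : ℕ) σ * (Zq I q a)⁻¹ := by
  simp [injPi, exch, div_eq_mul_inv]

/-- The vertical output is exchangeable with `a + b - d` arrows, so applying `Π` to it gives a total
mass `qBinom q I c` if that number is `c`, and 0 otherwise. -/
theorem fusedREntry_eq (I : ℕ) (q u : ℂ) (hq : q ≠ 0)
    (hx : ∀ k : ℤ, -(I : ℤ) ≤ k → k ≤ I → 1 - q ^ k * u ≠ 0) (a b c d : Fin (I + 1)) :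
    fusedREntry I q u a b c d = if (a : ℕ) + (b : ℕ) = c + d then
      (∑ δ : Fin I → Fin 2, if numArrows δ = d then
        qBinom q I (c : ℕ) * stackWeight q I I u (a : ℕ) (b : ℕ) δ else 0) *
      ((Zq I q a)⁻¹ * (Zq I q b)⁻¹) else 0 := by
  have h := stackOp_mulVec q u hq hx (Sum.inl : Fin I → Fin I ⊕ Fin I) Sum.inl_injective Sum.inr
    Sum.inr_injective (fun _ _ => Sum.inl_ne_inr) (a : ℕ) (b : ℕ)
    (fun _ => (Zq I q a)⁻¹ * (Zq I q b)⁻¹) (fun _ _ _ => rfl) (fun _ _ _ => rfl)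
  rw [fusedREntry, fusedR, Matrix.mul_assoc, Matrix.mul_apply,
    ← (Equiv.sumArrowEquivProdArrow (Fin I) (Fin I) (Fin 2)).symm.sum_comp, Fintype.sum_prod_type,
    Finset.sum_comm]
  have h' : ∀ τ, (fusedROp I q u * (injPi I q ⊗ₖ injPi I q).submatrix
      (Equiv.sumArrowEquivProdArrow (Fin I) (Fin I) (Fin 2)) id) τ (a, b) =
      stackWeight q I I u (a : ℕ) (b : ℕ) (τ ∘ Sum.inr) *
        (exch q ((a : ℕ) + (b : ℕ) - numArrows (τ ∘ Sum.inr)) (τ ∘ Sum.inl) *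
          ((Zq I q a)⁻¹ * (Zq I q b)⁻¹)) := by
    intro τ
    rw [← congrFun h τ, fusedROp_eq_stackOp I q u hq, Matrix.mul_apply]
    refine Finset.sum_congr rfl fun σ _ => ?_
    congr 1
    simp only [Matrix.submatrix_apply, Matrix.kroneckerMap_apply, injPi_apply, id]
    simp only [Equiv.sumArrowEquivProdArrow, Equiv.coe_fn_mk, Function.comp_def]
    ring
  simp only [h', Matrix.submatrix_apply, Equiv.apply_symm_apply, Matrix.kroneckerMap_apply, id,
    projPi, Matrix.of_apply]
  have e1 : ∀ σ δ : Fin I → Fin 2,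
      (Equiv.sumArrowEquivProdArrow (Fin I) (Fin I) (Fin 2)).symm (σ, δ) ∘ Sum.inl = σ :=
    fun _ _ => rfl
  have e2 : ∀ σ δ : Fin I → Fin 2,
      (Equiv.sumArrowEquivProdArrow (Fin I) (Fin I) (Fin 2)).symm (σ, δ) ∘ Sum.inr = δ :=
    fun _ _ => rfl
  simp only [e1, e2]
  have inner : ∀ δ : Fin I → Fin 2, ∑ σ : Fin I → Fin 2,
      ((if numArrows σ = (c : ℕ) then (1 : ℂ) else 0) * if numArrows δ = (d : ℕ) then 1 else 0) *
        (stackWeight q I I u (a : ℕ) (b : ℕ) δ *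
          (exch q ((a : ℕ) + (b : ℕ) - numArrows δ) σ * ((Zq I q a)⁻¹ * (Zq I q b)⁻¹))) =
      if (a : ℕ) + (b : ℕ) = c + d then (if numArrows δ = d then
        qBinom q I (c : ℕ) * stackWeight q I I u (a : ℕ) (b : ℕ) δ else 0) *
          ((Zq I q a)⁻¹ * (Zq I q b)⁻¹) else 0 := by
    intro δ
    by_cases hd : numArrows δ = d
    · simp only [hd, if_true, mul_one]
      have : ∀ σ : Fin I → Fin 2, (if numArrows σ = (c : ℕ) then (1 : ℂ) else 0) *
          exch q ((a : ℕ) + (b : ℕ) - (d : ℕ) : ℤ) σ =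
          if (a : ℕ) + (b : ℕ) = c + d then exch q (c : ℕ) σ else 0 := by
        intro σ
        simp only [exch]
        by_cases h1 : numArrows σ = c
        · by_cases h2 : (a : ℕ) + (b : ℕ) = c + d
          · simp only [h1, h2, if_true, one_mul]
            rw [if_pos (by omega)]
          · rw [if_neg h2, if_pos h1, if_neg (by omega), mul_zero]
        · by_cases h2 : (a : ℕ) + (b : ℕ) = c + d
          · simp [h1]
          · simp [h1]
      split_ifs with h2
      · rw [qBinom, mul_assoc, Finset.sum_mul]
        refine Finset.sum_congr rfl fun σ _ => ?_
        have := this σ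
        rw [if_pos h2] at this
        rw [← this]
        ring
      · refine Finset.sum_eq_zero fun σ _ => ?_
        have := this σ
        rw [if_neg h2] at this
        linear_combination (stackWeight q I I u (a : ℕ) (b : ℕ) δ *
          ((Zq I q a)⁻¹ * (Zq I q b)⁻¹)) * this
    · simp [hd]
  rw [Finset.sum_congr rfl fun δ _ => inner δ]
  split_ifs
  · rw [Finset.sum_mul]
  · simp

/-- The product with `(q; q)_a` has the factors `1 - q ^ (I - k)` for `k < a`, all nonzero. -/
theorem Zq_ne_zero {I : ℕ} {q : ℂ} (hq : q ≠ 0) (hroot : ∀ k, 1 ≤ k → k ≤ I → q ^ k ≠ 1) {a : ℕ}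
    (ha : a ≤ I) : Zq I q a ≠ 0 := by
  have h := qBinom_mul_qPoch q hq I a
  rw [← Zq_eq_qBinom] at h
  refine left_ne_zero_of_mul (b := qPoch q q a) ?_
  rw [h]
  refine qPoch_ne_zero fun k hk => ?_
  obtain ⟨j, rfl⟩ : ∃ j, I = k + (j + 1) := ⟨I - k - 1, by omega⟩
  rw [inv_pow, pow_add, inv_mul_cancel_left₀ (pow_ne_zero k hq), sub_ne_zero]
  exact (hroot _ (by omega) (by omega)).symm

/-- The binomial inside `stackTerm` is `Z_q(I; a)` and cancels. The symbols `(q ^ I; q⁻¹)` in the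
two `Φ` supply `Z_q(I; d)` and `Z_q(I; b)`, with `factRatio` converting factorials in `q` to those
in `q⁻¹`. -/
theorem stackTerm_eq_Phi {I : ℕ} {q u : ℂ} (hq : q ≠ 0) (hu : u ≠ 0)
    (hroot : ∀ k, 1 ≤ k → k ≤ I → q ^ k ≠ 1) {a b c d p : ℕ} (ha : a ≤ I) (hb : b ≤ I)
    (hd : d ≤ I) (hpb : p ≤ b) (hpc : p ≤ c) (habcd : a + b = c + d) :
    Zq I q d * stackTerm q I (q ^ I / u) u p (b - p) (c - p) d * ((Zq I q a)⁻¹ * (Zq I q b)⁻¹) =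
      u ^ ((d : ℤ) - b) * q ^ (((d : ℤ) - a) * I) *
        (Phi q⁻¹ (c - p) (c + d - p) u (q ^ I * u) * Phi q⁻¹ p b (q ^ I / u) (q ^ I)) := by
  have hQ : q ^ I ≠ 0 := pow_ne_zero I hq
  have e1 : ((c - p : ℕ) : ℤ) + d - (b - p : ℕ) = a := by omega
  have e2 : q ^ I / (q ^ I / u) = u := by field_simp
  have e3 : q ^ I * u / u = q ^ I := by field_simp
  have e4 : c + d - p - (c - p) = d := by omega
  have e5 : c - p + d = c + d - p := by omega
  have e6 : p + (b - p) = b := by omega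
  have hza := Zq_ne_zero hq hroot ha
  have hs : ∀ n ≤ I, qPoch q q n ≠ 0 := fun n hn => qPoch_ne_zero fun k hk => by
    rw [← pow_succ, sub_ne_zero]
    exact (hroot _ (by omega) (by omega)).symm
  have hsb := hs b hb
  have hsd := hs d hd
  have hzpow : u ^ ((d : ℤ) - b) * q ^ (((d : ℤ) - a) * I) * (q ^ I) ^ (c - p) * u ^ p =
      u ^ d * (q ^ I / u) ^ (b - p) := by
    have h1 : ((d : ℤ) - a) * I = ((b - p : ℕ) : ℤ) * I - ((c - p : ℕ) : ℤ) * I := by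
      rw [← sub_mul]; congr 1; omega
    have h2 : (d : ℤ) - b = d - ((b - p : ℕ) : ℤ) - p := by omega
    rw [h1, h2]
    simp only [zpow_sub₀ hq, zpow_sub₀ hu, ← Nat.cast_mul, zpow_natCast, div_pow, ← pow_mul,
      mul_comm _ I]
    field_simp
  rw [stackTerm, stackCoeff, Phi, Phi, e1, e2, e3, e4, e5, e6, ← Zq_eq_qBinom,
    qPoch_inv_self hq b, qPoch_inv_self hq d, ← qBinom_mul_qPoch q hq I b,
    ← qBinom_mul_qPoch q hq I d, ← Zq_eq_qBinom, ← Zq_eq_qBinom]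
  calc _ = (u ^ d * (q ^ I / u) ^ (b - p)) * (factRatio q b / factRatio q d * Zq I q d / Zq I q b *
        (Zq I q a * (Zq I q a)⁻¹) *
        (qPoch q⁻¹ (q ^ I / u) p * qPoch q⁻¹ u (b - p) /
          (qPoch q⁻¹ q⁻¹ p * qPoch q⁻¹ q⁻¹ (b - p))) *
        (qPoch q⁻¹ u (c - p) * qPoch q⁻¹ q⁻¹ (c + d - p) /
          (qPoch q⁻¹ (q ^ I * u) (c + d - p) * qPoch q⁻¹ q⁻¹ (c - p)))) := by ring
    _ = (u ^ d * (q ^ I / u) ^ (b - p)) * (factRatio q b / factRatio q d * Zq I q d / Zq I q b *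
        ((qPoch q q b * (qPoch q q b)⁻¹) * (qPoch q q d * (qPoch q q d)⁻¹)) *
        (qPoch q⁻¹ (q ^ I / u) p * qPoch q⁻¹ u (b - p) /
          (qPoch q⁻¹ q⁻¹ p * qPoch q⁻¹ q⁻¹ (b - p))) *
        (qPoch q⁻¹ u (c - p) * qPoch q⁻¹ q⁻¹ (c + d - p) /
          (qPoch q⁻¹ (q ^ I * u) (c + d - p) * qPoch q⁻¹ q⁻¹ (c - p)))) := by
        rw [mul_inv_cancel₀ hza, mul_inv_cancel₀ hsb, mul_inv_cancel₀ hsd, mul_one, mul_one, mul_one]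
    _ = _ := by
        rw [← hzpow]
        ring

/-- The explicit formula for the fused `R` matrix, for spectral parameters avoiding the powers of
`q` where a factor of the computation vanishes. -/
theorem fusedREntry_eq_of_generic (I : ℕ) (q u : ℂ) (hq : q ≠ 0) (hu : u ≠ 0)
    (hroot : ∀ k : ℕ, 1 ≤ k → k ≤ I → q ^ k ≠ 1)
    (hx : ∀ k : ℤ, -(I : ℤ) ≤ k → k ≤ I → 1 - q ^ k * u ≠ 0) (a b c d : Fin (I + 1)) :
    fusedREntry I q u a b c d =
      if (a : ℕ) + (b : ℕ) = (c : ℕ) + (d : ℕ) then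
        u ^ (((d : ℕ) : ℤ) - ((b : ℕ) : ℤ)) * q ^ ((((d : ℕ) : ℤ) - ((a : ℕ) : ℤ)) * (I : ℤ)) *
          ∑ p ∈ Finset.range (min (b : ℕ) (c : ℕ) + 1),
            Phi q⁻¹ ((c : ℕ) - p) ((c : ℕ) + (d : ℕ) - p) u (q ^ I * u) *
              Phi q⁻¹ p (b : ℕ) (q ^ I / u) (q ^ I)
      else 0 := by
  rw [fusedREntry_eq I q u hq hx]
  split_ifs with h
  · have hδ : ∀ δ : Fin I → Fin 2, (if numArrows δ = d then
        qBinom q I (c : ℕ) * stackWeight q I I u (a : ℕ) (b : ℕ) δ else 0) =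
        (if numArrows δ = d then q ^ inv δ else 0) *
          ∑ p ∈ Finset.range (min (b : ℕ) (c : ℕ) + 1),
            stackTerm q I (q ^ I / u) u p (b - p) (c - p) d := by
      intro δ
      split_ifs with hn
      · rw [← hn, ← stackWeight_eq q hq I I c (by omega) (by omega) hroot I hu hx b (by omega) δ, hn]
        congr 2
        omega
      · rw [zero_mul]
    rw [Finset.sum_congr rfl fun δ _ => hδ δ, ← Finset.sum_mul, ← Zq, Finset.mul_sum,
      Finset.sum_mul, Finset.mul_sum]
    refine Finset.sum_congr rfl fun p hp => ?_
    rw [Finset.mem_range] at hp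
    exact stackTerm_eq_Phi hq hu hroot (by omega) (by omega) (by omega) (by omega) (by omega) h
  · rfl

/-! ### Continuity in the spectral parameter -/

theorem continuousAt_fusedREntry (I : ℕ) (q u : ℂ)
    (hu : ∀ i j : Fin I, q * (u * q ^ (((i : ℕ) : ℤ) - ((j : ℕ) : ℤ))) ≠ 1) (a b c d : Fin (I + 1)) :
    ContinuousAt (fun v => fusedREntry I q v a b c d) u := by
  have hR : ∀ w : ℂ, q * (u * w) ≠ 1 → ∀ i j : Fin I ⊕ Fin I,
      ContinuousAt (fun v => actOn (unfusedR q (v * w)) i j) u := by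
    intro w hw i j
    have hD : 1 - q * (u * w) ≠ 0 := sub_ne_zero.2 hw.symm
    have hE : ∀ r b' s b : Fin 2, ContinuousAt (fun v => unfusedR q (v * w) (r, b') (s, b)) u := by
      intro r b' s b
      simp only [unfusedR_apply]
      fin_cases r <;> fin_cases b' <;> fin_cases s <;> fin_cases b <;>
        first
        | exact continuousAt_const
        | exact ContinuousAt.div (by fun_prop) (by fun_prop) hD
    refine continuousAt_pi.2 fun σ => continuousAt_pi.2 fun τ => ?_
    simp only [actOn, Matrix.of_apply]
    split_ifs
    · exact hE _ _ _ _
    · exact continuousAt_const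
  have hOp : ContinuousAt (fun v => fusedROp I q v) u :=
    tendsto_list_prod _ fun a _ => tendsto_list_prod _ fun b _ => hR _ (hu b a) _ _
  have hM : ContinuousAt (fun v => fusedR I q v) u :=
    ((continuous_const.matrix_mul continuous_id).matrix_mul continuous_const).continuousAt.comp hOp
  exact continuousAt_pi.1 (continuousAt_pi.1 hM _) _

theorem continuous_qPoch (s : ℂ) (n : ℕ) : Continuous fun x => qPoch s x n := by
  unfold qPoch
  fun_prop

/-- The only Pochhammer denominators that vary with `v` are `(q ^ I v; q⁻¹)_{c+d-p}`, and at `u`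
they are partial products of the nonzero product in `hcd`. -/
theorem continuousAt_formula (I : ℕ) (q u : ℂ) (hq : q ≠ 0) (hu : u ≠ 0) (a b c d : ℕ)
    (hcd : qPoch q⁻¹ (q ^ I * u) (c + d) ≠ 0) :
    ContinuousAt (fun v : ℂ => v ^ ((d : ℤ) - (b : ℤ)) * q ^ (((d : ℤ) - (a : ℤ)) * (I : ℤ)) *
      ∑ p ∈ Finset.range (min b c + 1), Phi q⁻¹ (c - p) (c + d - p) v (q ^ I * v) *
        Phi q⁻¹ p b (q ^ I / v) (q ^ I)) u := by
  have hQ : q ^ I / u ≠ 0 := div_ne_zero (pow_ne_zero I hq) hu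
  have hi : ContinuousAt (fun v : ℂ => q ^ I / v) u := continuousAt_const.div continuousAt_id hu
  have h1 : ContinuousAt (fun v : ℂ => q ^ I * v / v) u :=
    (continuousAt_const.mul continuousAt_id).div continuousAt_id hu
  have h2 : ContinuousAt (fun v : ℂ => q ^ I / (q ^ I / v)) u := continuousAt_const.div hi hQ
  have hm : ContinuousAt (fun v : ℂ => q ^ I * v) u := continuousAt_const.mul continuousAt_id
  have hp : ∀ (g : ℂ → ℂ) n, ContinuousAt g u → ContinuousAt (fun v => qPoch q⁻¹ (g v) n) u :=
    fun g n hg => (continuous_qPoch q⁻¹ n).continuousAt.comp hg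
  refine ((continuousAt_zpow₀ u _ (Or.inl hu)).mul continuousAt_const).mul
    (tendsto_finsetSum _ fun p _ => ?_)
  have hden : qPoch q⁻¹ (q ^ I * u) (c + d - p) ≠ 0 :=
    qPoch_ne_zero fun k hk => Finset.prod_ne_zero_iff.1 hcd k (Finset.mem_range.2 (by omega))
  unfold Phi
  refine ContinuousAt.mul (((h1.pow _).mul (((hp _ _ continuousAt_id).mul (hp _ _ h1)).div
    (hp _ _ hm) hden)).mul continuousAt_const) ?_
  exact ((h2.pow _).mul (((hp _ _ hi).mul (hp _ _ h2)).div_const _)).mul continuousAt_const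

end FusedSixVertex

end

open FusedSixVertex Topology Filter in
theorem mainTheorem9 (I : ℕ) (q u : ℂ) (hq0 : q ≠ 0) (hu0 : u ≠ 0)
    (hq : ∀ k : ℕ, 1 ≤ k → k ≤ I → q ^ k ≠ 1)
    (hu : ∀ i j : Fin I, q * (u * q ^ (((i : ℕ) : ℤ) - ((j : ℕ) : ℤ))) ≠ 1)
    (a b c d : Fin (I + 1))
    (hcd : FusedSixVertex.qPoch q⁻¹ (q ^ I * u) ((c : ℕ) + (d : ℕ)) ≠ 0) :
    FusedSixVertex.fusedREntry I q u a b c d =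
      if (a : ℕ) + (b : ℕ) = (c : ℕ) + (d : ℕ) then
        u ^ (((d : ℕ) : ℤ) - ((b : ℕ) : ℤ)) * q ^ ((((d : ℕ) : ℤ) - ((a : ℕ) : ℤ)) * (I : ℤ)) *
          ∑ p ∈ Finset.range (min (b : ℕ) (c : ℕ) + 1),
            FusedSixVertex.Phi q⁻¹ ((c : ℕ) - p) ((c : ℕ) + (d : ℕ) - p) u (q ^ I * u) *
              FusedSixVertex.Phi q⁻¹ p (b : ℕ) (q ^ I / u) (q ^ I)
      else 0 := by
  -- Each `1 - q ^ k * v` is affine in `v` with nonzero slope. If it vanishes at `u` it vanishes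
  -- nowhere else, so the generic formula holds on a punctured neighbourhood of every `u`.
  have hgen : ∀ᶠ v in 𝓝[≠] u, v ≠ 0 ∧
      ∀ k ∈ Finset.Icc (-(I : ℤ)) I, 1 - q ^ k * v ≠ 0 := by
    refine (eventually_nhdsWithin_of_eventually_nhds (eventually_ne_nhds hu0)).and
      ((Filter.eventually_all_finset _).2 fun k _ => ?_)
    have hk := zpow_ne_zero k hq0
    by_cases h : 1 - q ^ k * u = 0
    · filter_upwards [self_mem_nhdsWithin] with v hv hv'
      exact hv (mul_left_cancel₀ hk (by linear_combination h - hv'))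
    · have : ContinuousAt (fun v : ℂ => 1 - q ^ k * v) u := by fun_prop
      exact eventually_nhdsWithin_of_eventually_nhds (this.eventually_ne h)
  have hf := continuousAt_fusedREntry I q u hu a b c d
  have hg := continuousAt_formula I q u hq0 hu0 a b c d hcd
  have hev := hgen.mono fun v hv => fusedREntry_eq_of_generic I q v hq0 hv.1 hq
    (fun k h1 h2 => hv.2 k (Finset.mem_Icc.2 ⟨h1, h2⟩)) a b c d
  split_ifs with h
  · simp only [if_pos h] at hev
    exact ((hf.eventuallyEq_nhds_iff_eventuallyEq_nhdsNE hg).1 hev).eq_of_nhds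
  · simp only [if_neg h] at hev
    exact ((hf.eventuallyEq_nhds_iff_eventuallyEq_nhdsNE continuousAt_const).1 hev).eq_of_nhds
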